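/- Let $V$ be a finite vertex set with a chosen anchor vertex $v_0 \in V$, let $E_{\mathrm{init}}$ be a set of edges of the complete graph $K_V$ on $V$, and let $\mathcal{M}^+ \subseteq E(K_V) \setminus E_{\mathrm{init}}$ be a set of candidate edges. Put $E_\bullet = E_{\mathrm{init}} \cup \mathcal{M}^+$ and let $w$ assign a positive real weight to every edge in $E_\bullet$; write $G_\bullet = (V, E_\bullet, w)$. For each $e \in \mathcal{M}^+$ let $\pi_e \in [0,1]$, write $\pi = (\pi_e)_{e \in \mathcal{M}^+}$, and set $\pi_e = 1$ for $e \in E_{\mathrm{init}}$. Let $\mathcal{H}$ be a random spanning subgraph of $G_\bullet$ in which each edge $e \in E_\bullet$ appears with probability $\pi_e$, independently of the other edges (so the edges of $E_{\mathrm{init}}$ appear almost surely). For a graph $G = (V, E)$ with $E \subseteq E_\bullet$ let $$t_w(G) = \sum_{T} \prod_{e \in E(T)} w(e),$$ where $T$ ranges over the spanning trees of $G$. For an edge $e = \{u,v\}$ let $L_e = w(e)\, a_e a_e^\top$, where $a_e \in \mathbb{R}^{V \setminus \{v_0\}}$ is the vector $e_u - e_v$ of $\mathbb{R}^V$ (for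 either orientation of $e$) with the $v_0$ coordinate removed, and let $$L(\pi) = \sum_{e \in E_{\mathrm{init}}} L_e + \sum_{e \in \mathcal{M}^+} \pi_e L_e,$$ which is the reduced weighted Laplacian of $G_\bullet$ with the candidate weights scaled by $\pi$. Then both expectations below exist, and $$\mathbb{E}\big[t_w(\mathcal{H})\big] = \det L(\pi), \qquad \mathbb{E}\big[|E(\mathcal{H})| - |E_{\mathrm{init}}|\big] = \sum_{e \in \mathcal{M}^+} \pi_e = \|\pi\|_1 .$$ -/

import Mathlib

open MeasureTheory ProbabilityTheory

section GraphDefs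

variable {V : Type*}

/-- The graph `(V, E)` with edge set `E ⊆ E(K_V)`. -/
def graphOn (E : Finset (Sym2 V)) : SimpleGraph V :=
  SimpleGraph.fromEdgeSet (E : Set (Sym2 V))

/-- The finite set of spanning trees of `G`: trees on the whole vertex set `V` all of whose
edges are edges of `G`. -/
noncomputable def spanningTrees [Fintype V] (G : SimpleGraph V) : Finset (SimpleGraph V) := by
  classical exact {T : SimpleGraph V | T ≤ G ∧ T.IsTree}

/-- The value of a tree: the product of the weights of its edges. -/
noncomputable def treeValue [Fintype V] (w : Sym2 V → ℝ) (T : SimpleGraph V) : ℝ := by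
  classical exact ∏ e ∈ T.edgeFinset, w e

/-- The weighted number of spanning trees `t_w(G)`. Only the weights of edges of `G` matter. -/
noncomputable def weightedTreeCount [Fintype V] (w : Sym2 V → ℝ) (G : SimpleGraph V) : ℝ :=
  ∑ T ∈ spanningTrees G, treeValue w T

/-- The column `a_{uv} = e_u - e_v` of the reduced incidence matrix after anchoring `v₀`
(the row of `v₀` is removed). -/
def incidenceColumn [DecidableEq V] (v₀ u v : V) : {x : V // x ≠ v₀} → ℝ :=
  fun x => (if (x : V) = u then 1 else 0) - (if (x : V) = v then 1 else 0)

/-- The elementary reduced Laplacian `a_{uv} a_{uv}ᵀ` of the edge `{u, v}`; it does not depend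
on the orientation of the edge. -/
def elementaryLaplacian [DecidableEq V] (v₀ : V) :
    Sym2 V → Matrix {x : V // x ≠ v₀} {x : V // x ≠ v₀} ℝ :=
  Sym2.lift ⟨fun u v => Matrix.vecMulVec (incidenceColumn v₀ u v) (incidenceColumn v₀ u v), by
    intro u v
    ext x y
    simp only [Matrix.vecMulVec_apply, incidenceColumn]
    ring⟩

/-- The matrix `L(π)`: the reduced weighted Laplacian (anchored at `v₀`) of
`(V, Einit ∪ Mplus, w)` in which the weight of each candidate edge `j ∈ Mplus` is scaled
by `π j`. -/
noncomputable def reducedLaplacian [DecidableEq V] (v₀ : V) (w : Sym2 V → ℝ)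
    (Einit Mplus : Finset (Sym2 V)) (π : Mplus → ℝ) :
    Matrix {x : V // x ≠ v₀} {x : V // x ≠ v₀} ℝ :=
  ∑ e ∈ Einit, w e • elementaryLaplacian v₀ e +
    ∑ j : Mplus, π j • (w j • elementaryLaplacian v₀ (j : Sym2 V))

/-- The extended vector of probabilities: `π` on the candidate edges, `1` on all other edges. -/
def extendProb [DecidableEq V] {Mplus : Finset (Sym2 V)} (π : Mplus → ℝ) : Sym2 V → ℝ :=
  fun e => if h : e ∈ Mplus then π ⟨e, h⟩ else 1

/-- `H ∼ 𝔾(G, p)`: the random graph `H`, defined on the probability space `(Ω, P)`, is a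
spanning subgraph of `G` in which each edge `e` of `G` appears with probability `p e`,
independently of the other edges. -/
structure IsRandomSubgraph {Ω : Type*} [MeasurableSpace Ω] (P : Measure Ω)
    (G : SimpleGraph V) (p : Sym2 V → ℝ) (H : Ω → SimpleGraph V) : Prop where
  le : ∀ ω, H ω ≤ G
  measurableSet : ∀ e ∈ G.edgeSet, MeasurableSet {ω | e ∈ (H ω).edgeSet}
  prob : ∀ e ∈ G.edgeSet, P.real {ω | e ∈ (H ω).edgeSet} = p e
  indep : iIndepSet (fun e : G.edgeSet => {ω | (e : Sym2 V) ∈ (H ω).edgeSet}) P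

end GraphDefs

/-!
For a fixed set of edges, the weighted matrix-tree theorem identifies the weighted number of
spanning trees with the determinant of the reduced Laplacian, for arbitrary real edge weights
(`weightedTreeCount_graphOn_eq_det`). On the probabilistic side, a fixed spanning tree `T` of the
ambient graph survives in the random subgraph with probability `∏ e ∈ E(T), p e` by independence,
so by linearity of expectation the expected weighted tree count is the weighted tree count of the
ambient graph with each weight `w e` replaced by `w e * p e`
(`IsRandomSubgraph.integral_weightedTreeCount`). Applying the matrix-tree theorem to these modified
weights gives the determinant of `L(π)`. The statement on the number of edges is linearity of
expectation alone.

The matrix-tree theorem is obtained from a form of the Cauchy–Binet formula that needs no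
enumeration of the subsets involved: `det (∑ c_e a_e a_eᵀ)` is the sum over the sets `S` of `n`
indices of `∏ e ∈ S, c_e` times `det (∑ e ∈ S, a_e a_eᵀ)` (`det_sum_smul_vecMulVec`). When `S` is a
set of `|V| - 1` edges, the last determinant is `1` if `(V, S)` is a tree and `0` otherwise. If
`(V, S)` is disconnected, the indicator of the vertices that are not reachable from the anchor is a
kernel vector. If it is connected, sending each vertex to the first edge of a shortest path to the
anchor is a bijection onto `S`, and the resulting square matrix is triangular with respect to the
distance from the anchor, with diagonal entries `±1`.
-/

/-! ### A Cauchy–Binet formula for sums of rank-one matrices -/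

section CauchyBinet

variable {ι n R : Type*} [Fintype n] [DecidableEq n] [CommRing R]

/-- Multilinear expansion of the determinant: row `x` of the matrix is
`∑ e ∈ E, (c e * a e x) • a e`, and `f` records the summand chosen in each row. -/
theorem det_sum_smul_vecMulVec_eq_sum_piFinset (E : Finset ι) (a : ι → n → R) (c : ι → R) :
    (∑ e ∈ E, c e • Matrix.vecMulVec (a e) (a e)).det =
      ∑ f ∈ Fintype.piFinset (fun _ : n => E),
        (∏ x, c (f x)) * ((∏ x, a (f x) x) * (Matrix.of fun x => a (f x)).det) := by
  have hrows : (∑ e ∈ E, c e • Matrix.vecMulVec (a e) (a e)) =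
      Matrix.of fun x => ∑ e ∈ E, (c e * a e x) • a e := by
    ext x y
    simp [Matrix.sum_apply, Matrix.vecMulVec_apply, mul_assoc]
  rw [hrows]
  have h := (Matrix.detRowAlternating (n := n) (R := R)).toMultilinearMap.map_sum_finset
    (fun x e => (c e * a e x) • a e) (fun _ => E)
  refine h.trans (Finset.sum_congr rfl fun f _ => ?_)
  rw [MultilinearMap.map_smul_univ, Finset.prod_mul_distrib, smul_eq_mul, mul_assoc]
  rfl

theorem det_of_comp_eq_zero (a : ι → n → R) {f : n → ι} (hf : ¬ Function.Injective f) :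
    (Matrix.of fun x => a (f x)).det = 0 := by
  simp only [Function.Injective, not_forall] at hf
  obtain ⟨x, y, hxy, hne⟩ := hf
  exact Matrix.det_zero_of_row_eq hne (by ext z; simp [hxy])

/-- A choice-free Cauchy–Binet formula: the coefficient of `∏ e ∈ S, c e` is itself the
determinant of the unweighted sum over `S`, which is the squared maximal minor on the rows `S`. -/
theorem det_sum_smul_vecMulVec [DecidableEq ι] (E : Finset ι) (a : ι → n → R) (c : ι → R) :
    (∑ e ∈ E, c e • Matrix.vecMulVec (a e) (a e)).det =
      ∑ S ∈ E.powersetCard (Fintype.card n),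
        (∏ e ∈ S, c e) * (∑ e ∈ S, Matrix.vecMulVec (a e) (a e)).det := by
  classical
  have hcard {f : n → ι} (hf : Function.Injective f) :
      (Finset.univ.image f).card = Fintype.card n :=
    Finset.card_image_of_injective _ hf
  have himage {f : n → ι} (hf : Function.Injective f) {S : Finset ι}
      (hS : S.card = Fintype.card n) (hfS : f ∈ Fintype.piFinset (fun _ : n => S)) :
      Finset.univ.image f = S :=
    Finset.eq_of_subset_of_card_le
      (Finset.image_subset_iff.2 fun x _ => Fintype.mem_piFinset.1 hfS x) (by rw [hcard hf, hS])
  have hinj (S : Finset ι) (c : ι → R) :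
      (∑ e ∈ S, c e • Matrix.vecMulVec (a e) (a e)).det =
        ∑ f ∈ Fintype.piFinset (fun _ : n => S) with Function.Injective f,
          (∏ x, c (f x)) * ((∏ x, a (f x) x) * (Matrix.of fun x => a (f x)).det) := by
    rw [det_sum_smul_vecMulVec_eq_sum_piFinset]
    refine (Finset.sum_filter_of_ne fun f _ hne => ?_).symm
    by_contra hf
    exact hne (by rw [det_of_comp_eq_zero a hf, mul_zero, mul_zero])
  -- group the injective functions by their image; the functions with image `S` are those of the
  -- same expansion for the index set `S` and weights `1`
  rw [hinj, ← Finset.sum_fiberwise_of_maps_to (g := fun f : n → ι => Finset.univ.image f)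
    (t := E.powersetCard (Fintype.card n))]
  · refine Finset.sum_congr rfl fun S hS => ?_
    rw [Finset.mem_powersetCard] at hS
    have h1 := hinj S (fun _ => 1)
    simp only [one_smul, Finset.prod_const_one, one_mul] at h1
    rw [h1, Finset.mul_sum]
    have hset : ((Fintype.piFinset fun _ : n => E).filter Function.Injective).filter
          (fun f => Finset.univ.image f = S) =
        (Fintype.piFinset fun _ : n => S).filter Function.Injective := by
      ext f
      simp only [Finset.mem_filter]
      constructor
      · rintro ⟨⟨_, hf⟩, rfl⟩
        exact ⟨by simp, hf⟩
      · rintro ⟨hfS, hf⟩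
        exact ⟨⟨Fintype.mem_piFinset.2 fun x => hS.1 (Fintype.mem_piFinset.1 hfS x), hf⟩,
          himage hf hS.2 hfS⟩
    rw [hset]
    refine Finset.sum_congr rfl fun f hf => ?_
    rw [Finset.mem_filter] at hf
    rw [← himage hf.2 hS.2 hf.1, Finset.prod_image fun x _ y _ h => hf.2 h]
  · intro f hf
    rw [Finset.mem_filter] at hf
    rw [Finset.mem_powersetCard]
    exact ⟨Finset.image_subset_iff.2 fun x _ => Fintype.mem_piFinset.1 hf.1 x, hcard hf.2⟩

theorem det_sum_vecMulVec_image [DecidableEq ι] (a : ι → n → R) {g : n → ι}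
    (hg : Function.Injective g) :
    (∑ e ∈ Finset.univ.image g, Matrix.vecMulVec (a e) (a e)).det =
      (Matrix.of fun x => a (g x)).det * (Matrix.of fun x => a (g x)).det := by
  have h : ∑ e ∈ Finset.univ.image g, Matrix.vecMulVec (a e) (a e) =
      (Matrix.of fun x => a (g x)).transpose * Matrix.of fun x => a (g x) := by
    rw [Finset.sum_image fun x _ y _ h => hg h]
    ext x y
    simp [Matrix.sum_apply, Matrix.vecMulVec_apply, Matrix.mul_apply]
  rw [h, Matrix.det_mul, Matrix.det_transpose]

/-- A matrix that is triangular with respect to a rank function `d`, where distinct indices of equal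
rank have zero entries, has the product of its diagonal as determinant. No linear order on the
index type is needed. -/
theorem det_eq_prod_diag_of_rank_lt (A : Matrix n n R) (d : n → ℕ)
    (hA : ∀ i j, i ≠ j → A i j ≠ 0 → d j < d i) : A.det = ∏ i, A i i := by
  rw [Matrix.det_apply, Finset.sum_eq_single_of_mem 1 (Finset.mem_univ _)]
  · simp
  intro σ _ hσ
  suffices h : ∃ i, A (σ i) i = 0 by
    obtain ⟨i, hi⟩ := h
    have h0 : ∏ i, A (σ i) i = 0 := Finset.prod_eq_zero (Finset.mem_univ i) hi
    exact (congrArg (Equiv.Perm.sign σ • ·) h0).trans (smul_zero _)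
  by_contra! h
  have hle : ∀ i ∈ Finset.univ, d i ≤ d (σ i) := fun i _ => by
    by_cases hi : σ i = i
    · rw [hi]
    · exact (hA _ _ hi (h i)).le
  -- a permutation preserves the sum of the ranks, so it cannot weakly raise all of them unless it
  -- keeps each one
  have heq := (Finset.sum_eq_sum_iff_of_le hle).1 (Equiv.sum_comp σ d).symm
  refine hσ (Equiv.ext fun i => ?_)
  by_contra hi
  exact absurd (heq i (Finset.mem_univ i)) (hA _ _ hi (h i)).ne

end CauchyBinet

/-! ### The weighted matrix-tree theorem -/

section MatrixTree

variable {V : Type*}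

theorem edgeSet_graphOn {E : Finset (Sym2 V)}
    (hE : (E : Set (Sym2 V)) ⊆ (⊤ : SimpleGraph V).edgeSet) :
    (graphOn E).edgeSet = (E : Set (Sym2 V)) := by
  rw [graphOn, SimpleGraph.edgeSet_fromEdgeSet, sdiff_eq_left, Set.disjoint_left]
  intro e he hd
  exact SimpleGraph.not_isDiag_of_mem_edgeSet _ (hE he) hd

/-- The pairing of a reduced incidence column with a potential that vanishes at the anchor is the
potential difference along the edge, just as for the full incidence column. -/
theorem incidenceColumn_dotProduct [Fintype V] [DecidableEq V] {v₀ : V} (u v : V) {y : V → ℝ}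
    (hy : y v₀ = 0) :
    incidenceColumn v₀ u v ⬝ᵥ (fun x : {x : V // x ≠ v₀} => y x) = y u - y v := by
  have h := Finset.sum_subtype (F := inferInstance) (Finset.univ.erase v₀) (p := fun x => x ≠ v₀)
    (by simp) (fun x => ((if x = u then 1 else 0) - (if x = v then 1 else 0)) * y x)
  rw [dotProduct]
  refine h.symm.trans ?_
  rw [Finset.sum_erase _ (by simp [hy])]
  simp [sub_mul, Finset.sum_sub_distrib]

/-- A column of the reduced incidence matrix for the edge `e`, in an arbitrarily chosen
orientation. -/
noncomputable def orientedColumn [DecidableEq V] (v₀ : V) (e : Sym2 V) : {x : V // x ≠ v₀} → ℝ :=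
  incidenceColumn v₀ (Quot.out e).1 (Quot.out e).2

theorem elementaryLaplacian_eq_vecMulVec [DecidableEq V] (v₀ : V) (e : Sym2 V) :
    elementaryLaplacian v₀ e = Matrix.vecMulVec (orientedColumn v₀ e) (orientedColumn v₀ e) := by
  conv_lhs => rw [← Quot.out_eq e]
  rfl

/-- The squares of the entries do not depend on the orientation. -/
theorem orientedColumn_mul_self [DecidableEq V] (v₀ u v : V) (x : {x : V // x ≠ v₀}) :
    orientedColumn v₀ s(u, v) x * orientedColumn v₀ s(u, v) x =
      incidenceColumn v₀ u v x * incidenceColumn v₀ u v x :=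
  (congrFun (congrFun (elementaryLaplacian_eq_vecMulVec v₀ s(u, v)) x) x).symm

theorem det_sum_elementaryLaplacian_of_not_connected [Fintype V] [DecidableEq V] (v₀ : V)
    (S : Finset (Sym2 V)) (hS : ¬ (graphOn S).Connected) :
    (∑ e ∈ S, elementaryLaplacian v₀ e).det = 0 := by
  classical
  obtain ⟨x, hx⟩ : ∃ x, ¬ (graphOn S).Reachable v₀ x := by
    by_contra! h
    exact hS (SimpleGraph.connected_iff_exists_forall_reachable _ |>.2 ⟨v₀, h⟩)
  -- the indicator of the vertices not reachable from the anchor is in the kernel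
  set y : V → ℝ := fun z => if (graphOn S).Reachable v₀ z then 0 else 1 with hy
  have hy₀ : y v₀ = 0 := if_pos (SimpleGraph.Reachable.refl _)
  have hxv : x ≠ v₀ := by rintro rfl; exact hx (SimpleGraph.Reachable.refl _)
  refine Matrix.exists_mulVec_eq_zero_iff.1 ⟨fun z => y z, fun h => ?_, ?_⟩
  · have := congrFun h ⟨x, hxv⟩
    simp [hy, hx] at this
  rw [Matrix.sum_mulVec]
  refine Finset.sum_eq_zero fun e he => ?_
  induction e using Sym2.ind with | _ u v =>
  have huv : y u = y v := by
    by_cases h : u = v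
    · rw [h]
    have hadj : (graphOn S).Adj u v := by simpa [graphOn, h] using he
    have : (graphOn S).Reachable v₀ u ↔ (graphOn S).Reachable v₀ v :=
      ⟨fun h => h.trans hadj.reachable, fun h => h.trans hadj.symm.reachable⟩
    simp [hy, this]
  have hdef : elementaryLaplacian v₀ s(u, v) =
    Matrix.vecMulVec (incidenceColumn v₀ u v) (incidenceColumn v₀ u v) := rfl
  rw [hdef, Matrix.vecMulVec_mulVec, incidenceColumn_dotProduct u v hy₀, huv, sub_self]
  simp

theorem SimpleGraph.Connected.exists_adj_dist_add_one {G : SimpleGraph V} (hG : G.Connected)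
    {v₀ x : V} (hx : x ≠ v₀) : ∃ p, G.Adj x p ∧ G.dist p v₀ + 1 = G.dist x v₀ := by
  obtain ⟨q, hq⟩ := hG.exists_walk_length_eq_dist x v₀
  cases q with
  | nil => exact absurd rfl hx
  | @cons _ p _ h q =>
    refine ⟨p, h, ?_⟩
    have h1 := SimpleGraph.dist_le q
    have h2 := hG.dist_triangle (u := x) (v := p) (w := v₀)
    have h3 : G.dist x p = 1 := SimpleGraph.dist_eq_one_iff_adj.2 h
    rw [SimpleGraph.Walk.length_cons] at hq
    omega

theorem det_sum_elementaryLaplacian_of_connected [Fintype V] [DecidableEq V] (v₀ : V)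
    (S : Finset (Sym2 V)) (hcard : S.card = Fintype.card {x : V // x ≠ v₀})
    (hS : (graphOn S).Connected) :
    (∑ e ∈ S, elementaryLaplacian v₀ e).det = 1 := by
  choose p hadj hdist using fun x : {x : V // x ≠ v₀} => hS.exists_adj_dist_add_one x.2
  -- the edge from each vertex towards the anchor
  set g : {x : V // x ≠ v₀} → Sym2 V := fun x => s((x : V), p x) with hg
  have hinj : Function.Injective g := by
    intro x z h
    rcases Sym2.eq_iff.1 h with h | h
    · exact Subtype.ext h.1
    · have hx := hdist x
      have hz := hdist z
      rw [h.2] at hx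
      rw [← h.1] at hz
      omega
  have himage : Finset.univ.image g = S := by
    refine Finset.eq_of_subset_of_card_le (Finset.image_subset_iff.2 fun x _ => ?_) ?_
    · simpa using (SimpleGraph.fromEdgeSet_adj _).1 (hadj x) |>.1
    · rw [Finset.card_image_of_injective _ hinj, hcard, Finset.card_univ]
  simp only [elementaryLaplacian_eq_vecMulVec]
  rw [← himage, det_sum_vecMulVec_image _ hinj,
    det_eq_prod_diag_of_rank_lt (Matrix.of fun x => orientedColumn v₀ (g x))
      fun x => (graphOn S).dist (x : V) v₀,
    ← Finset.prod_mul_distrib]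
  · refine Finset.prod_eq_one fun x _ => ?_
    rw [Matrix.of_apply, hg, orientedColumn_mul_self]
    simp [incidenceColumn, (hadj x).ne]
  · -- the only vertex other than `x` on the edge `g x` is `p x`, which is closer to the anchor
    intro x z hxz hne
    have hne' : orientedColumn v₀ s((x : V), p x) z * orientedColumn v₀ s((x : V), p x) z ≠ 0 :=
      mul_ne_zero hne hne
    rw [orientedColumn_mul_self] at hne'
    have hz : (z : V) = p x := by
      by_contra h
      have : (z : V) ≠ x := fun h => hxz (Subtype.ext h.symm)
      simp [incidenceColumn, h, this] at hne'
    have := hdist x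
    rw [← hz] at this
    omega

theorem det_sum_elementaryLaplacian [Fintype V] [DecidableEq V] (v₀ : V)
    {S : Finset (Sym2 V)} (hS : (S : Set (Sym2 V)) ⊆ (⊤ : SimpleGraph V).edgeSet)
    (hcard : S.card = Fintype.card {x : V // x ≠ v₀}) [Decidable (graphOn S).IsTree] :
    (∑ e ∈ S, elementaryLaplacian v₀ e).det = if (graphOn S).IsTree then 1 else 0 := by
  have hiff : (graphOn S).IsTree ↔ (graphOn S).Connected := by
    rw [SimpleGraph.isTree_iff_connected_and_card, and_iff_left_iff_imp]
    intro _
    have hpos : 0 < Fintype.card V := Fintype.card_pos_iff.2 ⟨v₀⟩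
    have hc : Nat.card (graphOn S).edgeSet = S.card := by
      rw [edgeSet_graphOn hS]
      simp
    rw [hc, hcard, Fintype.card_subtype_compl, Nat.card_eq_fintype_card]
    simp
    omega
  split_ifs with h
  · exact det_sum_elementaryLaplacian_of_connected v₀ S hcard (hiff.1 h)
  · exact det_sum_elementaryLaplacian_of_not_connected v₀ S (mt hiff.2 h)

/-- The weighted matrix-tree theorem, for arbitrary real weights. -/
theorem weightedTreeCount_graphOn_eq_det [Fintype V] [DecidableEq V] (v₀ : V)
    {E : Finset (Sym2 V)} (hE : (E : Set (Sym2 V)) ⊆ (⊤ : SimpleGraph V).edgeSet)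
    (c : Sym2 V → ℝ) :
    weightedTreeCount c (graphOn E) = (∑ e ∈ E, c e • elementaryLaplacian v₀ e).det := by
  classical
  have hsub {S : Finset (Sym2 V)} (hS : S ⊆ E) :
      (S : Set (Sym2 V)) ⊆ (⊤ : SimpleGraph V).edgeSet :=
    (Finset.coe_subset.2 hS).trans hE
  have hdet : (∑ e ∈ E, c e • elementaryLaplacian v₀ e).det =
      ∑ S ∈ E.powersetCard (Fintype.card {x : V // x ≠ v₀}) with (graphOn S).IsTree,
        ∏ e ∈ S, c e := by
    simp only [elementaryLaplacian_eq_vecMulVec]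
    rw [det_sum_smul_vecMulVec, Finset.sum_filter]
    refine Finset.sum_congr rfl fun S hS => ?_
    rw [Finset.mem_powersetCard] at hS
    have := det_sum_elementaryLaplacian v₀ (hsub hS.1) hS.2
    simp only [elementaryLaplacian_eq_vecMulVec] at this
    rw [this]
    simp
  have hgraph (T : SimpleGraph V) : graphOn T.edgeFinset = T := by
    rw [graphOn, SimpleGraph.coe_edgeFinset, SimpleGraph.fromEdgeSet_edgeSet]
  have hedges {S : Finset (Sym2 V)} (hS : S ⊆ E) : (graphOn S).edgeFinset = S := by
    rw [← Finset.coe_inj, SimpleGraph.coe_edgeFinset, edgeSet_graphOn (hsub hS)]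
  rw [hdet, weightedTreeCount]
  refine Finset.sum_bij' (fun T _ => T.edgeFinset) (fun S _ => graphOn S) ?_ ?_ ?_ ?_ ?_
  · intro T hT
    simp only [spanningTrees, Finset.mem_filter, Finset.mem_univ, true_and] at hT
    have hcard := hT.2.card_edgeFinset
    rw [Finset.mem_filter, Finset.mem_powersetCard, hgraph]
    refine ⟨⟨?_, ?_⟩, hT.2⟩
    · rw [← Finset.coe_subset, SimpleGraph.coe_edgeFinset, ← edgeSet_graphOn hE]
      exact SimpleGraph.edgeSet_mono hT.1
    · rw [Fintype.card_subtype_compl]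
      simp
      omega
  · intro S hS
    simp only [Finset.mem_filter, Finset.mem_powersetCard] at hS
    simp only [spanningTrees, Finset.mem_filter, Finset.mem_univ, true_and]
    exact ⟨SimpleGraph.fromEdgeSet_mono (Finset.coe_subset.2 hS.1.1), hS.2⟩
  · intro T _
    exact hgraph T
  · intro S hS
    simp only [Finset.mem_filter, Finset.mem_powersetCard] at hS
    exact hedges hS.1.1
  · intro T _
    unfold treeValue
    congr!

end MatrixTree

/-! ### Expectations over the random subgraph -/

section Expectation

variable {V : Type*} {Ω : Type*} [MeasurableSpace Ω] {P : Measure Ω} {G : SimpleGraph V}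
  {p : Sym2 V → ℝ} {H : Ω → SimpleGraph V}

omit [MeasurableSpace Ω] in
theorem setOf_le_eq_biInter_edgeSet [Fintype V] (H : Ω → SimpleGraph V) (T : SimpleGraph V)
    [Fintype T.edgeSet] :
    {ω | T ≤ H ω} = ⋂ e ∈ T.edgeFinset, {ω | e ∈ (H ω).edgeSet} := by
  ext ω
  simp only [Set.mem_ofPred_eq, Set.mem_iInter, SimpleGraph.mem_edgeFinset,
    ← SimpleGraph.edgeSet_subset_edgeSet]
  rfl

theorem IsRandomSubgraph.measurableSet_le [Fintype V] (hH : IsRandomSubgraph P G p H)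
    {T : SimpleGraph V} (hT : T ≤ G) : MeasurableSet {ω | T ≤ H ω} := by
  classical
  rw [setOf_le_eq_biInter_edgeSet]
  exact Finset.measurableSet_biInter _ fun e he =>
    hH.measurableSet e (SimpleGraph.edgeSet_mono hT (SimpleGraph.mem_edgeFinset.1 he))

theorem IsRandomSubgraph.measureReal_le [Fintype V] (hH : IsRandomSubgraph P G p H)
    {T : SimpleGraph V} (hT : T ≤ G) [Fintype T.edgeSet] :
    P.real {ω | T ≤ H ω} = ∏ e ∈ T.edgeFinset, p e := by
  classical
  have hmem : ∀ e ∈ T.edgeFinset, e ∈ G.edgeSet := fun e he =>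
    SimpleGraph.edgeSet_mono hT (SimpleGraph.mem_edgeFinset.1 he)
  have hprod := (iIndepSet_iff_meas_biInter fun e : G.edgeSet => hH.measurableSet e e.2).1
    hH.indep (T.edgeFinset.subtype (· ∈ G.edgeSet))
  have hset : {ω | T ≤ H ω} = ⋂ e ∈ T.edgeFinset.subtype (· ∈ G.edgeSet),
      {ω | (e : Sym2 V) ∈ (H ω).edgeSet} := by
    rw [setOf_le_eq_biInter_edgeSet]
    ext ω
    simp only [Set.mem_iInter, Finset.mem_subtype, Subtype.forall]
    exact ⟨fun h e _ he => h e he, fun h e he => h e (hmem e he) he⟩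
  rw [hset, Measure.real, hprod, ENNReal.toReal_prod]
  rw [← Finset.prod_subtype_of_mem p hmem]
  exact Finset.prod_congr rfl fun e _ => hH.prob e e.2

theorem IsRandomSubgraph.weightedTreeCount_eq [Fintype V] (hH : IsRandomSubgraph P G p H)
    (w : Sym2 V → ℝ) (ω : Ω) :
    weightedTreeCount w (H ω) =
      ∑ T ∈ spanningTrees G, {ω | T ≤ H ω}.indicator (fun _ => treeValue w T) ω := by
  classical
  rw [weightedTreeCount]
  simp only [Set.indicator_apply, Set.mem_ofPred_eq]
  rw [← Finset.sum_filter]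
  refine Finset.sum_congr ?_ fun _ _ => rfl
  ext T
  simp only [spanningTrees, Finset.mem_filter, Finset.mem_univ, true_and]
  exact ⟨fun h => ⟨⟨h.1.trans (hH.le ω), h.2⟩, h.1⟩, fun h => ⟨h.2, h.1.2⟩⟩

theorem IsRandomSubgraph.integrable_weightedTreeCount [Fintype V] [IsFiniteMeasure P]
    (hH : IsRandomSubgraph P G p H) (w : Sym2 V → ℝ) :
    Integrable (fun ω => weightedTreeCount w (H ω)) P := by
  simp only [hH.weightedTreeCount_eq w]
  refine integrable_finsetSum _ fun T hT => ?_
  simp only [spanningTrees, Finset.mem_filter, Finset.mem_univ, true_and] at hT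
  exact (integrable_const _).indicator (hH.measurableSet_le hT.1)

/-- The expected weighted tree count is the weighted tree count of the ambient graph with weights
scaled by the edge probabilities. -/
theorem IsRandomSubgraph.integral_weightedTreeCount [Fintype V] [IsFiniteMeasure P]
    (hH : IsRandomSubgraph P G p H) (w : Sym2 V → ℝ) :
    ∫ ω, weightedTreeCount w (H ω) ∂P = weightedTreeCount (fun e => w e * p e) G := by
  classical
  simp only [hH.weightedTreeCount_eq w]
  have hmem {T : SimpleGraph V} (hT : T ∈ spanningTrees G) : T ≤ G := by
    simp only [spanningTrees, Finset.mem_filter, Finset.mem_univ, true_and] at hT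
    exact hT.1
  rw [integral_finsetSum _ fun T hT =>
    (integrable_const _).indicator (hH.measurableSet_le (hmem hT))]
  refine Finset.sum_congr rfl fun T hT => ?_
  rw [integral_indicator_const _ (hH.measurableSet_le (hmem hT)), hH.measureReal_le (hmem hT),
    smul_eq_mul, mul_comm]
  unfold treeValue
  rw [Finset.prod_mul_distrib]

theorem IsRandomSubgraph.ncard_edgeSet_eq {E : Finset (Sym2 V)} (hE : G.edgeSet = E)
    (hH : IsRandomSubgraph P G p H) (ω : Ω) :
    ((H ω).edgeSet.ncard : ℝ) =
      ∑ e ∈ E, {ω | e ∈ (H ω).edgeSet}.indicator (fun _ => (1 : ℝ)) ω := by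
  classical
  simp only [Set.indicator_apply, Set.mem_ofPred_eq]
  rw [Finset.sum_boole, ← Set.ncard_coe_finset]
  congr 2
  ext e
  simp only [Finset.coe_filter, Set.mem_ofPred_eq, iff_and_self]
  intro he
  have := SimpleGraph.edgeSet_mono (hH.le ω) he
  rwa [hE] at this

theorem IsRandomSubgraph.integrable_ncard_edgeSet [IsFiniteMeasure P]
    {E : Finset (Sym2 V)} (hE : G.edgeSet = E) (hH : IsRandomSubgraph P G p H) :
    Integrable (fun ω => ((H ω).edgeSet.ncard : ℝ)) P := by
  simp only [hH.ncard_edgeSet_eq hE]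
  exact integrable_finsetSum _ fun e he =>
    (integrable_const _).indicator (hH.measurableSet e (hE ▸ he))

theorem IsRandomSubgraph.integral_ncard_edgeSet [IsFiniteMeasure P]
    {E : Finset (Sym2 V)} (hE : G.edgeSet = E) (hH : IsRandomSubgraph P G p H) :
    ∫ ω, ((H ω).edgeSet.ncard : ℝ) ∂P = ∑ e ∈ E, p e := by
  simp only [hH.ncard_edgeSet_eq hE]
  rw [integral_finsetSum _ fun e he =>
    (integrable_const _).indicator (hH.measurableSet e (hE ▸ he))]
  refine Finset.sum_congr rfl fun e he => ?_
  have he' : e ∈ G.edgeSet := hE ▸ he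
  rw [integral_indicator_const _ (hH.measurableSet e he'), hH.prob e he', smul_eq_mul, mul_one]

/-- Splits a sum over all edges that depends on the extended probabilities into the certain edges
and the candidate edges. -/
theorem sum_union_extendProb [DecidableEq V] {M : Type*} [AddCommMonoid M]
    {Einit Mplus : Finset (Sym2 V)} (hd : Disjoint Einit Mplus) (π : Mplus → ℝ)
    (F : Sym2 V → ℝ → M) :
    ∑ e ∈ Einit ∪ Mplus, F e (extendProb π e) =
      ∑ e ∈ Einit, F e 1 + ∑ j : Mplus, F j (π j) := by
  rw [Finset.sum_union hd, ← Finset.sum_coe_sort Mplus]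
  congr 1
  · refine Finset.sum_congr rfl fun e he => ?_
    rw [extendProb, dif_neg (Finset.disjoint_left.1 hd he)]
  · refine Finset.sum_congr rfl fun j _ => ?_
    rw [extendProb, dif_pos j.2]

end Expectation

theorem mainTheorem4 {V : Type*} [Fintype V] [DecidableEq V] (v₀ : V)
    (Einit Mplus : Finset (Sym2 V))
    (hEinit : (Einit : Set (Sym2 V)) ⊆ (⊤ : SimpleGraph V).edgeSet)
    (hMplus : (Mplus : Set (Sym2 V)) ⊆ (⊤ : SimpleGraph V).edgeSet \ (Einit : Set (Sym2 V)))
    (w : Sym2 V → ℝ) (hw : ∀ e ∈ Einit ∪ Mplus, 0 < w e)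
    (π : Mplus → ℝ) (hπ : ∀ j, π j ∈ Set.Icc (0 : ℝ) 1)
    {Ω : Type*} [MeasurableSpace Ω] (P : Measure Ω) [IsProbabilityMeasure P]
    (H : Ω → SimpleGraph V)
    (hH : IsRandomSubgraph P (graphOn (Einit ∪ Mplus)) (extendProb π) H) :
    (Integrable (fun ω => weightedTreeCount w (H ω)) P ∧
      ∫ ω, weightedTreeCount w (H ω) ∂P = (reducedLaplacian v₀ w Einit Mplus π).det) ∧
    (Integrable (fun ω => ((H ω).edgeSet.ncard : ℝ) - (Einit.card : ℝ)) P ∧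
      ∫ ω, (((H ω).edgeSet.ncard : ℝ) - (Einit.card : ℝ)) ∂P = ∑ j, π j ∧
      ∑ j, π j = ‖WithLp.toLp 1 π‖) := by
  have hd : Disjoint Einit Mplus :=
    Finset.disjoint_left.2 fun e he he' => (hMplus he').2 he
  have hE : ((Einit ∪ Mplus : Finset (Sym2 V)) : Set (Sym2 V)) ⊆ (⊤ : SimpleGraph V).edgeSet := by
    rw [Finset.coe_union]
    exact Set.union_subset hEinit fun e he => (hMplus he).1
  have hedges := edgeSet_graphOn hE
  refine ⟨⟨hH.integrable_weightedTreeCount w, ?_⟩,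
    (hH.integrable_ncard_edgeSet hedges).sub (integrable_const _), ?_, ?_⟩
  · rw [hH.integral_weightedTreeCount w, weightedTreeCount_graphOn_eq_det v₀ hE,
      sum_union_extendProb hd π fun e t => (w e * t) • elementaryLaplacian v₀ e]
    simp only [reducedLaplacian, mul_one, smul_smul, mul_comm]
  · rw [integral_sub (hH.integrable_ncard_edgeSet hedges) (integrable_const _),
      hH.integral_ncard_edgeSet hedges, sum_union_extendProb hd π fun _ t => t]
    simp
  · rw [PiLp.norm_eq_of_L1]
    exact Finset.sum_congr rfl fun j _ => (Real.norm_of_nonneg (hπ j).1).symm
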